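/- Let $A,V,Q\in\mathbb R^{n\times n}$ with $V$ symmetric positive semidefinite and $Q$ symmetric. Let $x$ be a continuous solution of the linear stochastic differential equation $$dx(t)=A\,x(t)\,dt+dw(t),\qquad t\ge 0,$$ that is, almost surely $x(t)=x(0)+\int_0^t A\,x(s)\,ds+w(t)$ for all $t\ge0$, where $w$ is an $n$-dimensional Brownian motion started at $0$ with covariance $V\,dt$ (its increments are independent, and $w(t)-w(s)$ is Gaussian with mean $0$ and covariance matrix $(t-s)V$ for $0\le s\le t$), and where $x(0)$ is Gaussian (possibly degenerate) and independent of $w$. Write $\Sigma(t)=\mathbb E[x(t)x(t)^T]$ and $\Sigma_0=\Sigma(0)$, and for $T\ge 0$ let $$J_T=\int_0^T e^{2\alpha t}\,x(t)^TQ\,x(t)\,dt .$$ Assume that $\alpha=0$ and that $A$ is Sylvester, i.e. $A$ has no two complex eigenvalues $\lambda_i,\lambda_j$ (possibly $i=j$) with $\lambda_i=-\lambda_j$. Then the Lyapunov equation $A^T\bar X^Q+\bar X^QA+Q=0$ has a unique solution $\bar X^Q\in\mathbb R^{n\times n}$, the second moments $\Sigma(t)$ are finite for all $t\ge 0$, the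 cost $J_T$ is integrable, and $$\mathbb E[J_T]=\operatorname{tr}\Big(\big(\Sigma_0-\Sigma(T)+T\,V\big)\bar X^Q\Big).$$ -/

import Mathlib

open MeasureTheory ProbabilityTheory
open scoped NNReal Matrix

noncomputable section

namespace LQG

/-- The state space `ℝⁿ`. -/
abbrev State (n : ℕ) : Type := EuclideanSpace ℝ (Fin n)

/-- A real square matrix is Sylvester if it has no two complex eigenvalues `l`, `m`
(possibly equal) with `l = -m`. -/
def IsSylvester {n : ℕ} (A : Matrix (Fin n) (Fin n) ℝ) : Prop :=
  ∀ l m : ℂ,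
    Module.End.HasEigenvalue (Matrix.toLin' (A.map (algebraMap ℝ ℂ))) l →
    Module.End.HasEigenvalue (Matrix.toLin' (A.map (algebraMap ℝ ℂ))) m →
    l ≠ -m

/-- `X` solves the Lyapunov equation `Aᵀ X + X A + Q = 0`. -/
def IsDualLyapunovSolution {n : ℕ} (A Q X : Matrix (Fin n) (Fin n) ℝ) : Prop :=
  Aᵀ * X + X * A + Q = 0

variable {Ω : Type*} {mΩ : MeasurableSpace Ω}

/-- `w` is an `n`-dimensional Brownian motion started at `0` whose increments over `[s, t]` are
centered Gaussian with covariance matrix `(t - s) V`; that is, `dw` has covariance `V dt`. -/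
structure IsBrownianMotion {n : ℕ} (V : Matrix (Fin n) (Fin n) ℝ)
    (w : ℝ≥0 → Ω → State n) (P : Measure Ω) : Prop where
  zero : ∀ᵐ ω ∂P, w 0 ω = 0
  indep_increments : HasIndepIncrements w P
  law_increment : ∀ s t : ℝ≥0, s ≤ t →
    HasLaw (fun ω ↦ w t ω - w s ω) (multivariateGaussian 0 (((t : ℝ) - (s : ℝ)) • V)) P
  continuous_paths : ∀ᵐ ω ∂P, Continuous fun t ↦ w t ω

/-- `x` is a stochastic process with almost surely continuous paths that solves
`dx(t) = A x(t) dt + dw(t)`, i.e. almost surely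
`x(t) = x(0) + ∫₀ᵗ A x(s) ds + w(t)` for all `t ≥ 0`. -/
structure IsSolution {n : ℕ} (A : Matrix (Fin n) (Fin n) ℝ)
    (w x : ℝ≥0 → Ω → State n) (P : Measure Ω) : Prop where
  aemeasurable : ∀ t, AEMeasurable (x t) P
  continuous_paths : ∀ᵐ ω ∂P, Continuous fun t ↦ x t ω
  integral_eq : ∀ᵐ ω ∂P, ∀ t : ℝ≥0,
    x t ω = x 0 ω + (∫ s in (0 : ℝ)..t, Matrix.toEuclideanLin A (x s.toNNReal ω)) + w t ω

/-- The second moment matrix `Σ(t) = E[x(t) x(t)ᵀ]`. -/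
def secondMoment {n : ℕ} (x : ℝ≥0 → Ω → State n) (P : Measure Ω) (t : ℝ≥0) :
    Matrix (Fin n) (Fin n) ℝ :=
  Matrix.of fun i j ↦ ∫ ω, x t ω i * x t ω j ∂P

/-- The finite-time cost `J_T = ∫₀ᵀ e^{2αt} x(t)ᵀ Q x(t) dt`. -/
def finiteTimeCost {n : ℕ} (α : ℝ) (Q : Matrix (Fin n) (Fin n) ℝ)
    (x : ℝ≥0 → Ω → State n) (T : ℝ≥0) (ω : Ω) : ℝ :=
  ∫ t in (0 : ℝ)..T, Real.exp (2 * α * t) *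
    ((x t.toNNReal ω).ofLp ⬝ᵥ (Q *ᵥ (x t.toNNReal ω).ofLp))

end LQG

end

/-! The proof rests on the integrated moment equation Σ(T) = Σ₀ + ∫₀ᵀ (AΣ + ΣAᵀ) ds + T V. It gives
Σ₀ - Σ(T) + T V = -∫₀ᵀ (AΣ + ΣAᵀ) ds. Multiplying by a Lyapunov solution X and using cyclicity of
the trace turns the integrand into -tr((AᵀX + XA)Σ) = tr(QΣ), and Fubini identifies its time
integral with the expected cost.

The moment equation needs no Itô calculus. Write x = z + w with z(t) = x(0) + ∫₀ᵗ A x ds, which is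
differentiable in t. In the expansion of x xᵀ, the product z zᵀ obeys the ordinary product rule, w
wᵀ has mean T V, and the cross terms reduce to ∫ E[A x(s) w(s)ᵀ] ds because x(s) is uncorrelated
with w(T) - w(s) (`integral_state_mul_increment`). Integrability comes from a pathwise Grönwall
bound of x - w by x(0) and the time integral of ‖w‖.

Existence and uniqueness of X follow from injectivity of X ↦ AᵀX + XA (`lyapunov_injective`), since
the space of matrices has finite dimension. -/

noncomputable section

namespace LQG

/-! ### The Lyapunov equation -/

open Polynomial in
/-- An intertwiner of two elements with no common spectrum vanishes: `B X = X C`, `p(B) = 0` and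
`p(C)` invertible force `X = 0`. -/
lemma eq_zero_of_intertwine {R : Type*} {K : Type*} [CommRing K] [Ring R] [Algebra K R]
    {B C X : R} (h : B * X = X * C) (p : K[X]) (hB : aeval B p = 0) (hC : IsUnit (aeval C p)) :
    X = 0 := by
  have hsc : SemiconjBy X C B := h.symm
  have key : X * aeval C p = aeval B p * X := by
    clear hB hC
    induction p using Polynomial.induction_on' with
    | add p q hp hq => simp [mul_add, add_mul, hp, hq]
    | monomial k a =>
      have hk : X * C ^ k = B ^ k * X := hsc.pow_right k
      rw [aeval_monomial, aeval_monomial, ← mul_assoc, ← Algebra.commutes, mul_assoc, hk, mul_assoc]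
  rw [hB, zero_mul] at key
  exact hC.mul_left_eq_zero.mp key

/-- The equation says that X intertwines Aᵀ and -A. The characteristic polynomial of A annihilates
Aᵀ, and at -A it is invertible because A and -A share no complex eigenvalue. -/
lemma lyapunov_injective {n : ℕ} {A X : Matrix (Fin n) (Fin n) ℝ} (hA : IsSylvester A)
    (hX : Aᵀ * X + X * A = 0) : X = 0 := by
  -- The spectral mapping theorem below needs a polynomial of positive degree, which excludes
  -- dimension zero.
  rcases isEmpty_or_nonempty (Fin n) with hn | hn
  · exact Subsingleton.elim _ _
  set B : Matrix (Fin n) (Fin n) ℂ := A.map (algebraMap ℝ ℂ) with hBdef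
  set Y : Matrix (Fin n) (Fin n) ℂ := X.map (algebraMap ℝ ℂ) with hY
  have hYB : Bᵀ * Y = Y * (-B) := by
    have := congrArg (fun M : Matrix (Fin n) (Fin n) ℝ ↦ M.map (algebraMap ℝ ℂ)) hX
    simp only [Matrix.map_add _ (map_add (algebraMap ℝ ℂ)), Matrix.map_mul] at this
    rw [mul_neg]
    refine eq_neg_of_add_eq_zero_left ?_
    rw [hBdef, hY, ← Matrix.transpose_map, this]
    ext i j
    simp
  have hY0 : Y = 0 := by
    refine eq_zero_of_intertwine hYB B.charpoly ?_ ?_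
    · rw [← Matrix.charpoly_transpose]
      exact Matrix.aeval_self_charpoly _
    · by_contra hu
      have h0 : (0 : ℂ) ∈ spectrum ℂ (Polynomial.aeval (-B) B.charpoly) :=
        spectrum.zero_mem_iff ℂ |>.2 hu
      rw [spectrum.map_polynomial_aeval_of_degree_pos _ _ (by
        rw [Matrix.charpoly_degree_eq_dim]
        simpa using Fin.pos_iff_nonempty.2 hn)] at h0
      obtain ⟨m, hm, hm0⟩ := h0
      have hl : m ∈ spectrum ℂ B := by
        rw [Matrix.mem_spectrum_iff_isRoot_charpoly]
        exact hm0
      rw [← spectrum.neg_eq, Set.mem_neg] at hm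
      have key : ∀ l, l ∈ spectrum ℂ B → Module.End.HasEigenvalue (Matrix.toLin' B) l := by
        intro l hl
        rw [Module.End.hasEigenvalue_iff_mem_spectrum, Matrix.spectrum_toLin']
        exact hl
      exact hA m (-m) (key _ hl) (key _ hm) (by simp)
  ext i j
  have := congrFun (congrFun hY0 i) j
  simpa [hY] using this

/-- A Sylvester matrix has exactly one solution of its Lyapunov equation. -/
lemma existsUnique_lyapunov {n : ℕ} {A : Matrix (Fin n) (Fin n) ℝ} (hA : IsSylvester A)
    (Q : Matrix (Fin n) (Fin n) ℝ) :
    ∃! X : Matrix (Fin n) (Fin n) ℝ, IsDualLyapunovSolution A Q X := by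
  let φ : Matrix (Fin n) (Fin n) ℝ →ₗ[ℝ] Matrix (Fin n) (Fin n) ℝ :=
    LinearMap.mulLeft ℝ Aᵀ + LinearMap.mulRight ℝ A
  have hφ : ∀ X, φ X = Aᵀ * X + X * A := fun X ↦ rfl
  have hinj : Function.Injective φ := by
    rw [← LinearMap.ker_eq_bot, LinearMap.ker_eq_bot']
    exact fun X hX ↦ lyapunov_injective hA hX
  have hbij : Function.Bijective φ := ⟨hinj, LinearMap.injective_iff_surjective.1 hinj⟩
  obtain ⟨X, hX, hu⟩ := hbij.existsUnique (-Q)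
  refine ⟨X, ?_, fun Y hY ↦ hu Y ?_⟩
  · change _ + Q = 0
    rw [← hφ, hX, neg_add_cancel]
  · exact eq_neg_of_add_eq_zero_left hY

/-! ### Grönwall estimates for linear integral equations -/

/-- Pathwise Grönwall bound for a linear integral equation driven by a continuous path. -/
lemma norm_sub_le_of_integral_eq {E : Type*} [NormedAddCommGroup E] [NormedSpace ℝ E]
    [CompleteSpace E] (L : E →L[ℝ] E) {X u : ℝ → E} {a : E} {T : ℝ} (hT : 0 ≤ T)
    (hX : Continuous X) (hu : Continuous u)
    (h : ∀ t ∈ Set.Icc 0 T, X t = a + (∫ s in (0 : ℝ)..t, L (X s)) + u t) :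
    ∀ t ∈ Set.Icc 0 T, ‖X t - u t‖ ≤
      (Real.exp ((‖L‖ + 1) * T) * (1 + 2 * (‖L‖ + 1))) * (‖a‖ + ∫ s in (0 : ℝ)..T, ‖u s‖) := by
  intro t ht
  -- Adding 1 keeps the Grönwall constant nonzero even when L = 0.
  set K : ℝ := ‖L‖ + 1 with hK
  have hK0 : 0 < K := by positivity
  have hLK : ‖L‖ ≤ K := by rw [hK]; linarith
  set m : ℝ := ∫ s in (0 : ℝ)..T, ‖u s‖ with hm
  have hm0 : 0 ≤ m := intervalIntegral.integral_nonneg hT fun _ _ ↦ norm_nonneg _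
  -- X - u splits as h' + v: v depends on u alone and is bounded by K m, while h' is differentiable
  -- with ‖L (X - u)‖ ≤ K‖h'‖ + K(K m). Grönwall is applied to h', so u need not be differentiable.
  let v : ℝ → E := fun t ↦ ∫ s in (0 : ℝ)..t, L (u s)
  let h' : ℝ → E := fun t ↦ a + ∫ s in (0 : ℝ)..t, L (X s - u s)
  have hLu : Continuous fun s ↦ L (u s) := L.continuous.comp hu
  have hLX : Continuous fun s ↦ L (X s) := L.continuous.comp hX
  have hLXu : Continuous fun s ↦ L (X s - u s) := L.continuous.comp (hX.sub hu)
  have hv : ∀ t ∈ Set.Icc 0 T, ‖v t‖ ≤ K * m := by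
    intro t ht
    calc ‖v t‖ ≤ ∫ s in (0 : ℝ)..t, ‖L (u s)‖ :=
          intervalIntegral.norm_integral_le_integral_norm ht.1
      _ ≤ ∫ s in (0 : ℝ)..T, ‖L (u s)‖ :=
          intervalIntegral.integral_mono_interval le_rfl ht.1 ht.2
            (Filter.Eventually.of_forall fun _ ↦ norm_nonneg _) (hLu.norm.intervalIntegrable _ _)
      _ ≤ ∫ s in (0 : ℝ)..T, K * ‖u s‖ :=
          intervalIntegral.integral_mono hT (hLu.norm.intervalIntegrable _ _)
            ((hu.norm.const_mul K).intervalIntegrable _ _)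
            fun s ↦ (L.le_opNorm _).trans (by gcongr)
      _ = K * m := intervalIntegral.integral_const_mul _ _
  have hdecomp : ∀ t ∈ Set.Icc 0 T, X t - u t = h' t + v t := by
    intro t ht
    simp only [h', v]
    rw [add_assoc, ← intervalIntegral.integral_add (hLXu.intervalIntegrable _ _)
      (hLu.intervalIntegrable _ _)]
    simp only [map_sub, sub_add_cancel]
    rw [sub_eq_iff_eq_add, ← h t ht]
  have hder : ∀ t, HasDerivAt h' (L (X t - u t)) t := fun t ↦
    (intervalIntegral.integral_hasDerivAt_right (hLXu.intervalIntegrable _ _)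
      hLXu.stronglyMeasurable.stronglyMeasurableAtFilter hLXu.continuousAt).const_add a
  have hgr := norm_le_gronwallBound_of_norm_deriv_right_le (f := h')
    (f' := fun t ↦ L (X t - u t)) (δ := ‖a‖) (K := K) (ε := K * (K * m)) (a := 0) (b := T)
    (fun t _ ↦ (hder t).continuousAt.continuousWithinAt) (fun t _ ↦ (hder t).hasDerivWithinAt)
    (by simp [h']) (by
      intro t ht
      have ht' : t ∈ Set.Icc 0 T := ⟨ht.1, ht.2.le⟩
      have h1 : ‖L (X t - u t)‖ ≤ K * ‖X t - u t‖ := (L.le_opNorm _).trans (by gcongr)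
      have h2 : ‖X t - u t‖ ≤ ‖h' t‖ + K * m := by
        rw [hdecomp t ht']
        exact (norm_add_le _ _).trans (by gcongr; exact hv t ht')
      calc _ ≤ K * (‖h' t‖ + K * m) := h1.trans (by gcongr)
        _ = _ := by ring) t ht
  rw [gronwallBound_of_K_ne_0 hK0.ne', sub_zero, mul_div_cancel_left₀ _ hK0.ne'] at hgr
  have hexp : Real.exp (K * t) ≤ Real.exp (K * T) := by
    gcongr
    exact ht.2
  have hone : 1 ≤ Real.exp (K * T) := Real.one_le_exp (by positivity)
  have hKm : 0 ≤ K * m := by positivity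
  have ha := norm_nonneg a
  set e := Real.exp (K * T)
  calc ‖X t - u t‖ ≤ ‖h' t‖ + ‖v t‖ := by rw [hdecomp t ht]; exact norm_add_le _ _
    _ ≤ (‖a‖ * e + K * m * e) + e * (K * m) := by
        gcongr
        · exact hgr.trans (add_le_add (mul_le_mul_of_nonneg_left hexp ha)
            (mul_le_mul_of_nonneg_left (by linarith) hKm))
        · exact (hv t ht).trans (le_mul_of_one_le_left hKm hone)
    _ ≤ _ := by
        have : 0 ≤ e * m := by positivity
        have : 0 ≤ e * ‖a‖ * K := by positivity
        nlinarith

/-- A linear homogeneous integral equation on an interval has only the zero solution among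
integrable functions. -/
lemma eq_zero_of_integral_eq {n : ℕ} (A : Matrix (Fin n) (Fin n) ℝ) {g : ℝ → Fin n → ℝ} {T : ℝ}
    (hg : ∀ i, IntervalIntegrable (fun t ↦ g t i) volume 0 T)
    (h : ∀ t ∈ Set.Icc 0 T, ∀ i, g t i = ∫ s in (0 : ℝ)..t, ∑ k, A i k * g s k) :
    ∀ t ∈ Set.Icc 0 T, ∀ i, g t i = 0 := by
  intro t ht
  have hT : 0 ≤ T := ht.1.trans ht.2
  -- Integrability improves to continuity, because g equals a primitive.
  have hcont : ∀ i, ContinuousOn (fun t ↦ g t i) (Set.Icc 0 T) := by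
    intro i
    have hint : IntervalIntegrable (fun s ↦ ∑ k, A i k * g s k) volume 0 T := by
      have := IntervalIntegrable.sum Finset.univ (f := fun k s ↦ A i k * g s k)
        (fun k _ ↦ (hg k).const_mul (A i k))
      simpa only [Finset.sum_fn] using this
    have := intervalIntegral.continuousOn_primitive_interval
      ((intervalIntegrable_iff' (by simp)).1 hint)
    rw [Set.uIcc_of_le hT] at this
    exact this.congr fun t ht ↦ h t ht i
  let L : (Fin n → ℝ) →L[ℝ] (Fin n → ℝ) := LinearMap.toContinuousLinearMap (Matrix.toLin' A)
  -- The Grönwall bound asks for a path continuous on the whole line, so g is extended by its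
  -- endpoint values.
  let X : ℝ → Fin n → ℝ := fun t i ↦ g (Set.projIcc 0 T hT t) i
  have hX : Continuous X := continuous_pi fun i ↦
    (continuousOn_iff_continuous_domRestrict.1 (hcont i)).comp continuous_projIcc
  have hXg : ∀ t ∈ Set.Icc 0 T, X t = g t := by
    intro t ht
    simp [X, Set.projIcc_of_mem hT ht]
  have key := norm_sub_le_of_integral_eq L (X := X) (u := fun _ ↦ 0) (a := 0) hT hX
    continuous_const (by
      intro r hr
      have hLX : IntervalIntegrable (fun s ↦ L (X s)) volume 0 r :=
        (L.continuous.comp hX).intervalIntegrable _ _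
      ext i
      have hproj := (ContinuousLinearMap.proj (R := ℝ) (φ := fun _ : Fin n ↦ ℝ)
        i).intervalIntegral_comp_comm hLX
      simp only [ContinuousLinearMap.proj_apply] at hproj
      rw [hXg r hr, h r hr i, Pi.add_apply, Pi.add_apply, ← hproj]
      simp only [Pi.zero_apply, zero_add, add_zero]
      refine intervalIntegral.integral_congr fun s hs ↦ ?_
      rw [Set.uIcc_of_le hr.1] at hs
      simp [L, hXg s ⟨hs.1, hs.2.trans hr.2⟩, Matrix.mulVec, dotProduct]) t ht
  rw [hXg t ht] at key
  simp only [sub_zero, norm_zero, intervalIntegral.integral_zero, add_zero, mul_zero] at key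
  intro i
  rw [norm_le_zero_iff.1 key, Pi.zero_apply]

/-! ### Continuous and measurable versions -/

/-- A process with almost surely continuous paths whose time marginals are a.e. measurable becomes
continuous and measurable outright once it is set to `0` on any measurable set that contains a
suitable null set. -/
lemma exists_measurable_continuous_modification {Ω E : Type*} {mΩ : MeasurableSpace Ω}
    {P : Measure Ω} [NormedAddCommGroup E] [MeasurableSpace E] [BorelSpace E]
    {x : ℝ≥0 → Ω → E}
    (hm : ∀ t, AEMeasurable (x t) P) (hc : ∀ᵐ ω ∂P, Continuous fun t ↦ x t ω) :
    ∃ N : Set Ω, P N = 0 ∧ ∀ N' : Set Ω, N ⊆ N' → MeasurableSet N' →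
      (∀ ω, Continuous fun t ↦ N'ᶜ.indicator (x t) ω) ∧
      (∀ t, Measurable (N'ᶜ.indicator (x t))) := by
  -- Only countably many exceptional null sets can be discarded, so measurable representatives are
  -- used at dense times and the other times are reached as limits.
  let d : ℕ → ℝ≥0 := TopologicalSpace.denseSeq ℝ≥0
  have hbad : ∀ᵐ ω ∂P, (Continuous fun t ↦ x t ω) ∧ ∀ k, x (d k) ω = (hm (d k)).mk _ ω := by
    filter_upwards [hc, ae_all_iff.2 fun k ↦ (hm (d k)).ae_eq_mk] with ω h1 h2 using ⟨h1, h2⟩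
  refine ⟨_, ae_iff.1 hbad, fun N' hN hN' ↦ ?_⟩
  have hgood : ∀ ω ∉ N', (Continuous fun t ↦ x t ω) ∧ ∀ k, x (d k) ω = (hm (d k)).mk _ ω :=
    fun ω hω ↦ by
      by_contra hcon
      exact hω (hN hcon)
  have hcont : ∀ ω, Continuous fun t ↦ N'ᶜ.indicator (x t) ω := by
    intro ω
    by_cases hω : ω ∈ N'
    · simpa [hω] using continuous_const
    · simpa [hω] using (hgood ω hω).1
  refine ⟨hcont, fun t ↦ ?_⟩
  obtain ⟨q, hq, hqt⟩ := mem_closure_iff_seq_limit.1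
    ((TopologicalSpace.denseRange_denseSeq ℝ≥0) t)
  refine measurable_of_tendsto_metrizable (f := fun k ↦ N'ᶜ.indicator (x (q k))) (fun k ↦ ?_)
    (tendsto_pi_nhds.2 fun ω ↦ ((hcont ω).tendsto t).comp hqt)
  obtain ⟨l, hl⟩ := hq k
  have : N'ᶜ.indicator (x (q k)) = N'ᶜ.indicator ((hm (d l)).mk _) := by
    rw [← hl]
    refine Set.indicator_congr fun ω hω ↦ (hgood ω hω).2 l
  rw [this]
  exact (hm (d l)).measurable_mk.indicator hN'.compl

/-! ### Regular systems and square integrability -/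

variable {n : ℕ} {Ω : Type*} {mΩ : MeasurableSpace Ω}

/-- A linear stochastic differential equation in which both the driving noise `w` and the solution
`x` are measurable with continuous paths everywhere, and in which only the second order properties
of the initial state and the noise are recorded. -/
structure RegularSystem (A V : Matrix (Fin n) (Fin n) ℝ) (w x : ℝ → Ω → State n)
    (P : Measure Ω) : Prop where
  measurable_noise : ∀ t, Measurable (w t)
  continuous_noise : ∀ ω, Continuous fun t ↦ w t ω
  measurable_state : ∀ t, Measurable (x t)
  continuous_state : ∀ ω, Continuous fun t ↦ x t ω
  integral_eq : ∀ ω, ∀ t, 0 ≤ t →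
    x t ω = x 0 ω + (∫ s in (0 : ℝ)..t, Matrix.toEuclideanLin A (x s ω)) + w t ω
  memLp_zero : MemLp (x 0) 2 P
  memLp_noise : ∀ t, 0 ≤ t → MemLp (w t) 2 P
  moment_noise : ∀ t, 0 ≤ t → ∀ i j, ∫ ω, w t ω i * w t ω j ∂P = t * V i j
  orthogonal_zero : ∀ t, 0 ≤ t → ∀ i j, ∫ ω, x 0 ω i * w t ω j ∂P = 0
  orthogonal_increment : ∀ r s t, 0 ≤ r → r ≤ s → s ≤ t → ∀ i j,
    ∫ ω, w r ω i * (w t ω j - w s ω j) ∂P = 0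

lemma memLp_apply {α : Type*} {m : MeasurableSpace α} {μ : Measure α} {f : α → State n}
    (hf : MemLp f 2 μ) (i : Fin n) : MemLp (fun a ↦ f a i) 2 μ :=
  hf.continuousLinearMap_comp (EuclideanSpace.proj (𝕜 := ℝ) i)

/-- Cauchy–Schwarz on [0, T], obtained by expanding the nonnegative integral of (T f - c)², where c
= ∫ f. -/
lemma integral_sq_le {f : ℝ → ℝ} (hf : Continuous f) {T : ℝ} (hT : 0 ≤ T) :
    (∫ s in (0 : ℝ)..T, f s) ^ 2 ≤ T * ∫ s in (0 : ℝ)..T, f s ^ 2 := by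
  rcases hT.eq_or_lt with rfl | hT
  · simp
  set c := ∫ s in (0 : ℝ)..T, f s with hc
  have h : 0 ≤ ∫ s in (0 : ℝ)..T, (T * f s - c) ^ 2 :=
    intervalIntegral.integral_nonneg hT.le fun _ _ ↦ sq_nonneg _
  have hexp : ∫ s in (0 : ℝ)..T, (T * f s - c) ^ 2
      = T ^ 2 * (∫ s in (0 : ℝ)..T, f s ^ 2) - T * c ^ 2 := by
    have : (fun s ↦ (T * f s - c) ^ 2) = fun s ↦ T ^ 2 * f s ^ 2 - 2 * T * c * f s + c ^ 2 := by
      funext s; ring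
    rw [this, intervalIntegral.integral_add, intervalIntegral.integral_sub,
      intervalIntegral.integral_const_mul, intervalIntegral.integral_const_mul,
      intervalIntegral.integral_const, ← hc]
    · simp only [sub_zero, smul_eq_mul]; ring
    all_goals exact Continuous.intervalIntegrable (by fun_prop) _ _
  rw [hexp] at h
  by_contra hlt
  push Not at hlt
  nlinarith [mul_lt_mul_of_pos_left hlt hT]

instance isFiniteMeasure_restrict_uIoc (a b : ℝ) :
    IsFiniteMeasure (volume.restrict (Set.uIoc a b)) :=
  ⟨by simp [Set.uIoc]⟩

lemma integral_add_three {μ : Measure Ω} {f g k : Ω → ℝ} (hf : Integrable f μ)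
    (hg : Integrable g μ) (hk : Integrable k μ) :
    ∫ ω, (f ω + g ω + k ω) ∂μ = ∫ ω, f ω ∂μ + ∫ ω, g ω ∂μ + ∫ ω, k ω ∂μ := by
  have h := integral_add (hf.add hg) hk
  simp only [Pi.add_apply] at h
  rw [h, integral_add hf hg]

namespace RegularSystem

variable {A V : Matrix (Fin n) (Fin n) ℝ} {w x : ℝ → Ω → State n} {P : Measure Ω}

/-- The drift `(A x(t))ᵢ`. -/
def drift (A : Matrix (Fin n) (Fin n) ℝ) (x : ℝ → Ω → State n) (i : Fin n) (t : ℝ) (ω : Ω) : ℝ :=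
  ∑ k, A i k * x t ω k

lemma continuous_drift (h : RegularSystem A V w x P) (i : Fin n) (ω : Ω) :
    Continuous fun t ↦ drift A x i t ω := by
  have := h.continuous_state ω
  unfold drift
  fun_prop

lemma apply_eq (h : RegularSystem A V w x P) (ω : Ω) {t : ℝ} (ht : 0 ≤ t) (i : Fin n) :
    x t ω i = x 0 ω i + (∫ s in (0 : ℝ)..t, drift A x i s ω) + w t ω i := by
  let L : State n →L[ℝ] State n := LinearMap.toContinuousLinearMap (Matrix.toEuclideanLin A)
  have hint : IntervalIntegrable (fun s ↦ L (x s ω)) volume 0 t :=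
    (L.continuous.comp (h.continuous_state ω)).intervalIntegrable _ _
  have hproj := (EuclideanSpace.proj (𝕜 := ℝ) i : State n →L[ℝ] ℝ).intervalIntegral_comp_comm hint
  have := congrArg (fun v : State n ↦ v i) (h.integral_eq ω t ht)
  simp only [PiLp.add_apply] at this
  rw [this]
  congr 2
  refine hproj.symm.trans (intervalIntegral.integral_congr fun s _ ↦ ?_)
  simp [L, drift, Matrix.toLpLin_apply, Matrix.mulVec, dotProduct]

variable [IsProbabilityMeasure P]

/-- Lebesgue measure on `(0, T]` times the probability measure. -/
abbrev timeProd (T : ℝ) (P : Measure Ω) : Measure (ℝ × Ω) :=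
  (volume.restrict (Set.uIoc 0 T)).prod P

/-- By Tonelli it is enough that E‖w(s)‖² = s tr V is integrable in s over [0, T]. -/
lemma memLp_prod_noise (h : RegularSystem A V w x P) {T : ℝ} (hT : 0 ≤ T) :
    MemLp (fun p : ℝ × Ω ↦ w p.1 p.2) 2 (timeProd T P) := by
  have hm : StronglyMeasurable (fun p : ℝ × Ω ↦ w p.1 p.2) :=
    stronglyMeasurable_uncurry_of_continuous_of_stronglyMeasurable h.continuous_noise
      fun t ↦ (h.measurable_noise t).stronglyMeasurable
  rw [memLp_two_iff_integrable_sq_norm hm.aestronglyMeasurable,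
    integrable_prod_iff (f := fun p : ℝ × Ω ↦ ‖w p.1 p.2‖ ^ 2)
      (hm.norm.pow 2).aestronglyMeasurable]
  have hnn : ∀ᵐ s ∂(volume.restrict (Set.uIoc 0 T)), 0 ≤ s := by
    rw [Set.uIoc_of_le hT]
    filter_upwards [ae_restrict_mem measurableSet_Ioc] with s hs using hs.1.le
  constructor
  · filter_upwards [hnn] with s hs
    exact (memLp_two_iff_integrable_sq_norm (h.memLp_noise s hs).1).1 (h.memLp_noise s hs)
  · have heq : (fun s ↦ ∫ ω, ‖‖w s ω‖ ^ 2‖ ∂P) =ᵐ[volume.restrict (Set.uIoc 0 T)]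
        fun s ↦ s * ∑ i, V i i := by
      filter_upwards [hnn] with s hs
      simp only [norm_pow, norm_norm]
      simp only [EuclideanSpace.real_norm_sq_eq]
      rw [integral_finsetSum]
      · rw [Finset.mul_sum]
        refine Finset.sum_congr rfl fun i _ ↦ ?_
        rw [← h.moment_noise s hs i i]
        simp only [sq]
      · exact fun i _ ↦ (memLp_apply (h.memLp_noise s hs) i).integrable_sq
    refine Integrable.congr ?_ heq.symm
    rw [← IntegrableOn, ← intervalIntegrable_iff]
    exact Continuous.intervalIntegrable (by fun_prop) _ _

/-- A square integrable random variable controlling `x - w` on `[0, T]`. -/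
lemma exists_memLp_bound (h : RegularSystem A V w x P) {T : ℝ} (hT : 0 ≤ T) :
    ∃ M : Ω → ℝ, MemLp M 2 P ∧ ∀ ω, ∀ t ∈ Set.Icc 0 T, ‖x t ω - w t ω‖ ≤ M ω := by
  let L : State n →L[ℝ] State n := LinearMap.toContinuousLinearMap (Matrix.toEuclideanLin A)
  refine ⟨fun ω ↦ (Real.exp ((‖L‖ + 1) * T) * (1 + 2 * (‖L‖ + 1))) *
    (‖x 0 ω‖ + ∫ s in (0 : ℝ)..T, ‖w s ω‖), ?_, fun ω ↦ ?_⟩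
  · refine (h.memLp_zero.norm.add ?_).const_mul _
    have hm : StronglyMeasurable (fun p : ℝ × Ω ↦ w p.1 p.2) :=
      stronglyMeasurable_uncurry_of_continuous_of_stronglyMeasurable h.continuous_noise
        fun t ↦ (h.measurable_noise t).stronglyMeasurable
    have hmeas : AEStronglyMeasurable (fun ω ↦ ∫ s in (0 : ℝ)..T, ‖w s ω‖) P := by
      simp only [intervalIntegral.integral_of_le hT]
      exact (StronglyMeasurable.integral_prod_left hm.norm).aestronglyMeasurable
    rw [memLp_two_iff_integrable_sq hmeas]
    have hint := (memLp_two_iff_integrable_sq_norm hm.aestronglyMeasurable).1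
      (h.memLp_prod_noise hT)
    have hint' := hint.integral_prod_right
    rw [Set.uIoc_of_le hT] at hint'
    refine (hint'.const_mul T).mono' (hmeas.pow 2) (Filter.Eventually.of_forall fun ω ↦ ?_)
    rw [Real.norm_of_nonneg (sq_nonneg _), ← intervalIntegral.integral_of_le hT]
    exact integral_sq_le (h.continuous_noise ω).norm hT
  · exact norm_sub_le_of_integral_eq L hT (h.continuous_state ω) (h.continuous_noise ω)
      fun t ht ↦ h.integral_eq ω t ht.1

lemma memLp_state (h : RegularSystem A V w x P) {t : ℝ} (ht : 0 ≤ t) : MemLp (x t) 2 P := by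
  obtain ⟨M, hM, hb⟩ := h.exists_memLp_bound ht
  have : MemLp (fun ω ↦ x t ω - w t ω) 2 P :=
    hM.mono' ((h.measurable_state t).sub (h.measurable_noise t)).aestronglyMeasurable
      (Filter.Eventually.of_forall fun ω ↦ hb ω t ⟨ht, le_rfl⟩)
  have := this.add (h.memLp_noise t ht)
  refine this.congr_norm (h.measurable_state t).aestronglyMeasurable
    (Filter.Eventually.of_forall fun ω ↦ by simp)

lemma memLp_prod_state (h : RegularSystem A V w x P) {T : ℝ} (hT : 0 ≤ T) :
    MemLp (fun p : ℝ × Ω ↦ x p.1 p.2) 2 (timeProd T P) := by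
  obtain ⟨M, hM, hb⟩ := h.exists_memLp_bound hT
  have hmx : StronglyMeasurable (fun p : ℝ × Ω ↦ x p.1 p.2) :=
    stronglyMeasurable_uncurry_of_continuous_of_stronglyMeasurable h.continuous_state
      fun t ↦ (h.measurable_state t).stronglyMeasurable
  have hmw : StronglyMeasurable (fun p : ℝ × Ω ↦ w p.1 p.2) :=
    stronglyMeasurable_uncurry_of_continuous_of_stronglyMeasurable h.continuous_noise
      fun t ↦ (h.measurable_noise t).stronglyMeasurable
  have hM' : MemLp (fun p : ℝ × Ω ↦ M p.2) 2 (timeProd T P) := hM.comp_snd _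
  have hmem : ∀ᵐ p ∂(timeProd T P), p.1 ∈ Set.Icc 0 T := by
    have : ∀ᵐ s ∂(volume.restrict (Set.uIoc 0 T)), s ∈ Set.Icc 0 T := by
      rw [Set.uIoc_of_le hT]
      filter_upwards [ae_restrict_mem measurableSet_Ioc] with s hs using ⟨hs.1.le, hs.2⟩
    exact Measure.quasiMeasurePreserving_fst.ae this
  have : MemLp (fun p : ℝ × Ω ↦ x p.1 p.2 - w p.1 p.2) 2 (timeProd T P) := by
    refine hM'.mono' (hmx.sub hmw).aestronglyMeasurable ?_
    filter_upwards [hmem] with p hp using hb p.2 p.1 hp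
  have := this.add (h.memLp_prod_noise hT)
  refine this.congr_norm hmx.aestronglyMeasurable (Filter.Eventually.of_forall fun p ↦ by simp)

lemma memLp_drift (h : RegularSystem A V w x P) (i : Fin n) {t : ℝ} (ht : 0 ≤ t) :
    MemLp (drift A x i t) 2 P :=
  memLp_finsetSum _ fun k _ ↦ (memLp_apply (h.memLp_state ht) k).const_mul (A i k)

lemma memLp_prod_drift (h : RegularSystem A V w x P) (i : Fin n) {T : ℝ} (hT : 0 ≤ T) :
    MemLp (fun p : ℝ × Ω ↦ drift A x i p.1 p.2) 2 (timeProd T P) :=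
  memLp_finsetSum _ fun k _ ↦ (memLp_apply (h.memLp_prod_state hT) k).const_mul (A i k)

/-! ### Correlations between state and noise -/

/-- Fubini for the time integral of a square integrable process against a square integrable random
variable. -/
lemma integral_intervalIntegral_mul {f : ℝ → Ω → ℝ} {b : Ω → ℝ} {T : ℝ}
    (hf : MemLp (fun p : ℝ × Ω ↦ f p.1 p.2) 2 (timeProd T P)) (hb : MemLp b 2 P) :
    ∫ ω, (∫ s in (0 : ℝ)..T, f s ω) * b ω ∂P = ∫ s in (0 : ℝ)..T, ∫ ω, f s ω * b ω ∂P := by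
  rw [intervalIntegral_integral_swap (f := fun s ω ↦ f s ω * b ω)]
  · simp only [intervalIntegral.integral_mul_const]
  · exact hf.integrable_mul (hb.comp_snd _)

lemma intervalIntegrable_integral {f : ℝ → Ω → ℝ} {T : ℝ}
    (hf : Integrable (fun p : ℝ × Ω ↦ f p.1 p.2) (timeProd T P)) :
    IntervalIntegrable (fun s ↦ ∫ ω, f s ω ∂P) volume 0 T := by
  rw [intervalIntegrable_iff, IntegrableOn]
  exact hf.integral_prod_left

/-- The state is uncorrelated with future increments of the noise. -/
lemma integral_state_mul_increment (h : RegularSystem A V w x P) {r s t : ℝ} (hr : 0 ≤ r)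
    (hrs : r ≤ s) (hst : s ≤ t) (i j : Fin n) :
    ∫ ω, x r ω i * (w t ω j - w s ω j) ∂P = 0 := by
  have hs : 0 ≤ s := hr.trans hrs
  have ht : 0 ≤ t := hs.trans hst
  have hb : MemLp (fun ω ↦ w t ω j - w s ω j) 2 P :=
    (memLp_apply (h.memLp_noise t ht) j).sub (memLp_apply (h.memLp_noise s hs) j)
  -- As a function of r, the correlation vector solves g(r) = ∫₀ʳ A g: the contributions of x(0) and
  -- w(r) vanish. Hence g = 0, with no appeal to a filtration.
  refine eq_zero_of_integral_eq A (T := s)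
    (g := fun r i ↦ ∫ ω, x r ω i * (w t ω j - w s ω j) ∂P) (fun i ↦ ?_) (fun r hr i ↦ ?_)
    r ⟨hr, hrs⟩ i
  · exact intervalIntegrable_integral
      ((memLp_apply (h.memLp_prod_state hs) i).integrable_mul (hb.comp_snd _))
  · have hdr := h.memLp_prod_drift i hr.1
    have hfub := integral_intervalIntegral_mul hdr hb
    have h1 : Integrable (fun ω ↦ x 0 ω i * (w t ω j - w s ω j)) P :=
      (memLp_apply h.memLp_zero i).integrable_mul hb
    have h3 : Integrable (fun ω ↦ w r ω i * (w t ω j - w s ω j)) P :=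
      (memLp_apply (h.memLp_noise r hr.1) i).integrable_mul hb
    have h0 : Integrable (fun ω ↦ x r ω i * (w t ω j - w s ω j)) P :=
      (memLp_apply (h.memLp_state hr.1) i).integrable_mul hb
    have h2 : Integrable (fun ω ↦ (∫ u in (0 : ℝ)..r, drift A x i u ω) *
        (w t ω j - w s ω j)) P := by
      refine ((h0.sub h1).sub h3).congr (Filter.Eventually.of_forall fun ω ↦ ?_)
      simp only [Pi.sub_apply]
      rw [h.apply_eq ω hr.1 i]
      ring
    have hz : ∫ ω, x 0 ω i * (w t ω j - w s ω j) ∂P = 0 := by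
      simp only [mul_sub]
      rw [integral_sub, h.orthogonal_zero t ht, h.orthogonal_zero s hs, sub_zero]
      · exact (memLp_apply h.memLp_zero i).integrable_mul (memLp_apply (h.memLp_noise t ht) j)
      · exact (memLp_apply h.memLp_zero i).integrable_mul (memLp_apply (h.memLp_noise s hs) j)
    have hsplit : ∫ ω, x r ω i * (w t ω j - w s ω j) ∂P
        = ∫ ω, (x 0 ω i * (w t ω j - w s ω j) + (∫ u in (0 : ℝ)..r, drift A x i u ω) *
          (w t ω j - w s ω j)) + w r ω i * (w t ω j - w s ω j) ∂P := by
      refine integral_congr_ae (Filter.Eventually.of_forall fun ω ↦ ?_)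
      simp only
      rw [h.apply_eq ω hr.1 i]
      ring
    rw [hsplit, integral_add_three h1 h2 h3, hz, hfub,
      h.orthogonal_increment r s t hr.1 hr.2 hst, zero_add, add_zero]
    refine intervalIntegral.integral_congr fun u hu ↦ ?_
    rw [Set.uIcc_of_le hr.1] at hu
    simp only [drift, Finset.sum_mul]
    rw [integral_finsetSum]
    · refine Finset.sum_congr rfl fun k _ ↦ ?_
      rw [← integral_const_mul]
      simp only [mul_assoc]
    · intro k _
      exact ((memLp_apply (h.memLp_state hu.1) k).const_mul (A i k)).integrable_mul hb

/-- The correlation of the smooth part of the state with the noise. -/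
lemma integral_sub_mul_noise (h : RegularSystem A V w x P) {T : ℝ} (hT : 0 ≤ T) (i j : Fin n) :
    ∫ ω, (x T ω i - w T ω i) * w T ω j ∂P
      = ∫ s in (0 : ℝ)..T, ∫ ω, drift A x i s ω * w s ω j ∂P := by
  have hw := memLp_apply (h.memLp_noise T hT) j
  have hx0 : Integrable (fun ω ↦ x 0 ω i * w T ω j) P :=
    (memLp_apply h.memLp_zero i).integrable_mul hw
  have hz : Integrable (fun ω ↦ (x T ω i - w T ω i) * w T ω j) P :=
    ((memLp_apply (h.memLp_state hT) i).sub (memLp_apply (h.memLp_noise T hT) i)).integrable_mul hw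
  have hsplit : ∫ ω, (x T ω i - w T ω i) * w T ω j ∂P - ∫ ω, x 0 ω i * w T ω j ∂P
      = ∫ ω, (∫ s in (0 : ℝ)..T, drift A x i s ω) * w T ω j ∂P := by
    rw [← integral_sub hz hx0]
    refine integral_congr_ae (Filter.Eventually.of_forall fun ω ↦ ?_)
    simp only
    rw [h.apply_eq ω hT i]
    ring
  rw [h.orthogonal_zero T hT, sub_zero] at hsplit
  rw [hsplit, integral_intervalIntegral_mul (h.memLp_prod_drift i hT) hw]
  refine intervalIntegral.integral_congr fun s hs ↦ ?_
  rw [Set.uIcc_of_le hT] at hs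
  have hws := memLp_apply (h.memLp_noise s hs.1) j
  have hd := h.memLp_drift i hs.1
  have hI1 : Integrable (fun ω ↦ drift A x i s ω * w T ω j) P := hd.integrable_mul hw
  have hI2 : Integrable (fun ω ↦ drift A x i s ω * w s ω j) P := hd.integrable_mul hws
  simp only
  -- Replacing w(T) by w(s) changes the expectation by a correlation of x(s) with a future
  -- increment, which is zero.
  rw [← sub_eq_zero, ← integral_sub hI1 hI2]
  simp only [← mul_sub]
  simp only [drift, Finset.sum_mul]
  rw [integral_finsetSum]
  · refine Finset.sum_eq_zero fun k _ ↦ ?_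
    simp only [mul_assoc]
    rw [integral_const_mul, h.integral_state_mul_increment hs.1 le_rfl hs.2, mul_zero]
  · intro k _
    exact ((memLp_apply (h.memLp_state hs.1) k).const_mul (A i k)).integrable_mul (hw.sub hws)

/-! ### The moment equation -/

/-- The second moments of the smooth part of the state. -/
lemma integral_sub_mul_sub (h : RegularSystem A V w x P) {T : ℝ} (hT : 0 ≤ T) (i j : Fin n) :
    ∫ ω, (x T ω i - w T ω i) * (x T ω j - w T ω j) ∂P = ∫ ω, x 0 ω i * x 0 ω j ∂P +
      ∫ s in (0 : ℝ)..T, ∫ ω, (drift A x i s ω * (x s ω j - w s ω j) +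
        (x s ω i - w s ω i) * drift A x j s ω) ∂P := by
  have hdiff : ∀ k, MemLp (fun p : ℝ × Ω ↦ x p.1 p.2 k - w p.1 p.2 k) 2 (timeProd T P) :=
    fun k ↦ (memLp_apply (h.memLp_prod_state hT) k).sub (memLp_apply (h.memLp_prod_noise hT) k)
  have hdiffT : ∀ k, MemLp (fun ω ↦ x T ω k - w T ω k) 2 P :=
    fun k ↦ (memLp_apply (h.memLp_state hT) k).sub (memLp_apply (h.memLp_noise T hT) k)
  rw [intervalIntegral_integral_swap (f := fun s ω ↦ drift A x i s ω * (x s ω j - w s ω j) +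
        (x s ω i - w s ω i) * drift A x j s ω)]
  · have hI : Integrable (fun ω ↦ (x T ω i - w T ω i) * (x T ω j - w T ω j)) P :=
      (hdiffT i).integrable_mul (hdiffT j)
    have hI0 : Integrable (fun ω ↦ x 0 ω i * x 0 ω j) P :=
      (memLp_apply h.memLp_zero i).integrable_mul (memLp_apply h.memLp_zero j)
    rw [← sub_eq_iff_eq_add', ← integral_sub hI hI0]
    refine integral_congr_ae (Filter.Eventually.of_forall fun ω ↦ ?_)
    -- For fixed ω, z is differentiable on the whole line and equals x - w at nonnegative times, so
    -- integration by parts applies.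
    let z : Fin n → ℝ → ℝ := fun k t ↦ x 0 ω k + ∫ s in (0 : ℝ)..t, drift A x k s ω
    have hz : ∀ k, ∀ t, 0 ≤ t → x t ω k - w t ω k = z k t := fun k t ht ↦ by
      rw [h.apply_eq ω ht k]
      simp [z]
    have hder : ∀ k t, HasDerivAt (z k) (drift A x k t ω) t := fun k t ↦
      (intervalIntegral.integral_hasDerivAt_right
        ((h.continuous_drift k ω).intervalIntegrable _ _)
        (h.continuous_drift k ω).stronglyMeasurable.stronglyMeasurableAtFilter
        (h.continuous_drift k ω).continuousAt).const_add _
    have hparts := intervalIntegral.integral_deriv_mul_eq_sub (a := 0) (b := T)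
      (fun t _ ↦ hder i t) (fun t _ ↦ hder j t)
      ((h.continuous_drift i ω).intervalIntegrable _ _)
      ((h.continuous_drift j ω).intervalIntegrable _ _)
    have h0 : ∀ k, z k 0 = x 0 ω k := fun k ↦ by simp [z]
    rw [h0, h0, ← hz i T hT, ← hz j T hT] at hparts
    simp only
    rw [← hparts]
    refine intervalIntegral.integral_congr fun s hs ↦ ?_
    rw [Set.uIcc_of_le hT] at hs
    simp only [hz _ s hs.1]
  · exact ((h.memLp_prod_drift i hT).integrable_mul (hdiff j)).add
      ((hdiff i).integrable_mul (h.memLp_prod_drift j hT))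

/-- The integrated Lyapunov differential equation for the second moments. -/
lemma integral_state_mul_state (h : RegularSystem A V w x P) {T : ℝ} (hT : 0 ≤ T) (i j : Fin n) :
    ∫ ω, x T ω i * x T ω j ∂P = ∫ ω, x 0 ω i * x 0 ω j ∂P +
      (∫ s in (0 : ℝ)..T, ∫ ω, (drift A x i s ω * x s ω j + x s ω i * drift A x j s ω) ∂P)
        + T * V i j := by
  have hx := fun k ↦ memLp_apply (h.memLp_state hT) k
  have hw := fun k ↦ memLp_apply (h.memLp_noise T hT) k
  have hPx := fun k ↦ memLp_apply (h.memLp_prod_state hT) k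
  have hPw := fun k ↦ memLp_apply (h.memLp_prod_noise hT) k
  have hPd := fun k ↦ h.memLp_prod_drift k hT
  have hI1 : Integrable (fun ω ↦ (x T ω i - w T ω i) * (x T ω j - w T ω j)) P :=
    ((hx i).sub (hw i)).integrable_mul ((hx j).sub (hw j))
  have hI2 : Integrable (fun ω ↦ (x T ω i - w T ω i) * w T ω j) P :=
    ((hx i).sub (hw i)).integrable_mul (hw j)
  have hI3 : Integrable (fun ω ↦ (x T ω j - w T ω j) * w T ω i) P :=
    ((hx j).sub (hw j)).integrable_mul (hw i)
  have hI4 : Integrable (fun ω ↦ w T ω i * w T ω j) P := (hw i).integrable_mul (hw j)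
  have hexpand : ∫ ω, x T ω i * x T ω j ∂P
      = ∫ ω, ((x T ω i - w T ω i) * (x T ω j - w T ω j) + (x T ω i - w T ω i) * w T ω j
        + ((x T ω j - w T ω j) * w T ω i + w T ω i * w T ω j)) ∂P := by
    refine integral_congr_ae (Filter.Eventually.of_forall fun ω ↦ ?_)
    simp only
    ring
  have hA1 : IntervalIntegrable (fun s ↦ ∫ ω, (drift A x i s ω * (x s ω j - w s ω j) +
        (x s ω i - w s ω i) * drift A x j s ω) ∂P) volume 0 T :=
    intervalIntegrable_integral (((hPd i).integrable_mul ((hPx j).sub (hPw j))).add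
      (((hPx i).sub (hPw i)).integrable_mul (hPd j)))
  have hA2 : IntervalIntegrable (fun s ↦ ∫ ω, drift A x i s ω * w s ω j ∂P) volume 0 T :=
    intervalIntegrable_integral ((hPd i).integrable_mul (hPw j))
  have hA3 : IntervalIntegrable (fun s ↦ ∫ ω, drift A x j s ω * w s ω i ∂P) volume 0 T :=
    intervalIntegrable_integral ((hPd j).integrable_mul (hPw i))
  -- The two cross terms supply exactly the drift times w missing from the smooth part, restoring x
  -- in place of x - w.
  have hcombine : (∫ s in (0 : ℝ)..T, ∫ ω, (drift A x i s ω * x s ω j +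
        x s ω i * drift A x j s ω) ∂P)
      = (∫ s in (0 : ℝ)..T, ∫ ω, (drift A x i s ω * (x s ω j - w s ω j) +
        (x s ω i - w s ω i) * drift A x j s ω) ∂P)
        + (∫ s in (0 : ℝ)..T, ∫ ω, drift A x i s ω * w s ω j ∂P)
        + ∫ s in (0 : ℝ)..T, ∫ ω, drift A x j s ω * w s ω i ∂P := by
    rw [← intervalIntegral.integral_add hA1 hA2, ← intervalIntegral.integral_add (hA1.add hA2) hA3]
    refine intervalIntegral.integral_congr fun s hs ↦ ?_
    rw [Set.uIcc_of_le hT] at hs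
    have hxs := fun k ↦ memLp_apply (h.memLp_state hs.1) k
    have hws := fun k ↦ memLp_apply (h.memLp_noise s hs.1) k
    have hds := fun k ↦ h.memLp_drift k hs.1
    have hJ1 : Integrable (fun ω ↦ drift A x i s ω * (x s ω j - w s ω j) +
        (x s ω i - w s ω i) * drift A x j s ω) P :=
      ((hds i).integrable_mul ((hxs j).sub (hws j))).add
        (((hxs i).sub (hws i)).integrable_mul (hds j))
    have hJ2 : Integrable (fun ω ↦ drift A x i s ω * w s ω j) P := (hds i).integrable_mul (hws j)
    have hJ3 : Integrable (fun ω ↦ drift A x j s ω * w s ω i) P := (hds j).integrable_mul (hws i)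
    simp only
    rw [← integral_add_three hJ1 hJ2 hJ3]
    refine integral_congr_ae (Filter.Eventually.of_forall fun ω ↦ ?_)
    simp only
    ring
  have hI34 : Integrable (fun ω ↦ (x T ω j - w T ω j) * w T ω i + w T ω i * w T ω j) P :=
    hI3.add hI4
  rw [hexpand, integral_add_three hI1 hI2 hI34, integral_add hI3 hI4,
    h.integral_sub_mul_sub hT, h.integral_sub_mul_noise hT, h.integral_sub_mul_noise hT,
    h.moment_noise T hT, hcombine]
  ring

/-- The second moment matrix at real times. -/
def moment (x : ℝ → Ω → State n) (P : Measure Ω) (t : ℝ) : Matrix (Fin n) (Fin n) ℝ :=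
  Matrix.of fun i j ↦ ∫ ω, x t ω i * x t ω j ∂P

lemma intervalIntegrable_moment (h : RegularSystem A V w x P) {T : ℝ} (hT : 0 ≤ T) (i j : Fin n) :
    IntervalIntegrable (fun t ↦ moment x P t i j) volume 0 T :=
  intervalIntegrable_integral
    ((memLp_apply (h.memLp_prod_state hT) i).integrable_mul
      (memLp_apply (h.memLp_prod_state hT) j))

lemma moment_eq (h : RegularSystem A V w x P) {T : ℝ} (hT : 0 ≤ T) (i j : Fin n) :
    moment x P T i j = moment x P 0 i j +
      (∫ s in (0 : ℝ)..T, (A * moment x P s + moment x P s * Aᵀ) i j) + T * V i j := by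
  change ∫ ω, x T ω i * x T ω j ∂P = ∫ ω, x 0 ω i * x 0 ω j ∂P + _ + _
  rw [h.integral_state_mul_state hT]
  congr 2
  refine intervalIntegral.integral_congr fun s hs ↦ ?_
  rw [Set.uIcc_of_le hT] at hs
  have hxs := fun k ↦ memLp_apply (h.memLp_state hs.1) k
  have hint : ∀ k l, Integrable (fun ω ↦ x s ω k * x s ω l) P :=
    fun k l ↦ (hxs k).integrable_mul (hxs l)
  have hds := fun k ↦ h.memLp_drift k hs.1
  have h1 : Integrable (fun ω ↦ drift A x i s ω * x s ω j) P := (hds i).integrable_mul (hxs j)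
  have h2 : Integrable (fun ω ↦ x s ω i * drift A x j s ω) P := (hxs i).integrable_mul (hds j)
  simp only
  rw [integral_add h1 h2]
  simp only [drift, Finset.sum_mul, Finset.mul_sum, mul_assoc, mul_left_comm _ (A _ _)]
  rw [integral_finsetSum _ fun k _ ↦ (hint k j).const_mul _,
    integral_finsetSum _ fun k _ ↦ (hint i k).const_mul _]
  simp only [integral_const_mul]
  simp only [moment, Matrix.add_apply, Matrix.mul_apply, Matrix.of_apply,
    Matrix.transpose_apply, mul_comm (A j _)]

/-! ### The expected cost -/

/-- The running cost written with the products of the coordinates. -/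
lemma quadratic_eq_sum (Q : Matrix (Fin n) (Fin n) ℝ) (v : State n) :
    v.ofLp ⬝ᵥ (Q *ᵥ v.ofLp) = ∑ i, ∑ j, Q i j * (v i * v j) := by
  simp only [dotProduct, Matrix.mulVec, Finset.mul_sum]
  exact Finset.sum_congr rfl fun i _ ↦ Finset.sum_congr rfl fun j _ ↦ by ring

lemma integrable_prod_quadratic (h : RegularSystem A V w x P) (Q : Matrix (Fin n) (Fin n) ℝ)
    {T : ℝ} (hT : 0 ≤ T) :
    Integrable (fun p : ℝ × Ω ↦ (x p.1 p.2).ofLp ⬝ᵥ (Q *ᵥ (x p.1 p.2).ofLp)) (timeProd T P) := by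
  simp only [quadratic_eq_sum]
  exact integrable_finsetSum _ fun i _ ↦ integrable_finsetSum _ fun j _ ↦
    ((memLp_apply (h.memLp_prod_state hT) i).integrable_mul
      (memLp_apply (h.memLp_prod_state hT) j)).const_mul _

lemma integrable_cost (h : RegularSystem A V w x P) (Q : Matrix (Fin n) (Fin n) ℝ)
    {T : ℝ} (hT : 0 ≤ T) :
    Integrable (fun ω ↦ ∫ t in (0 : ℝ)..T, (x t ω).ofLp ⬝ᵥ (Q *ᵥ (x t ω).ofLp)) P := by
  have := (h.integrable_prod_quadratic Q hT).integral_prod_right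
  simpa only [Set.uIoc_of_le hT, ← intervalIntegral.integral_of_le hT] using this

/-- The expected cost over `[0, T]` in terms of a solution of the Lyapunov equation. -/
lemma integral_cost (h : RegularSystem A V w x P) {Q X : Matrix (Fin n) (Fin n) ℝ}
    (hX : IsDualLyapunovSolution A Q X) {T : ℝ} (hT : 0 ≤ T) :
    ∫ ω, (∫ t in (0 : ℝ)..T, (x t ω).ofLp ⬝ᵥ (Q *ᵥ (x t ω).ofLp)) ∂P =
      Matrix.trace ((moment x P 0 - moment x P T + T • V) * X) := by
  rw [← intervalIntegral_integral_swap (f := fun t ω ↦ (x t ω).ofLp ⬝ᵥ (Q *ᵥ (x t ω).ofLp))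
    (h.integrable_prod_quadratic Q hT)]
  -- The moment equation cancels T V, leaving only the linear drift of the moments.
  have hdrift : ∀ i j, (moment x P 0 - moment x P T + T • V) i j =
      ∫ s in (0 : ℝ)..T, -(A * moment x P s + moment x P s * Aᵀ) i j := by
    intro i j
    rw [Matrix.add_apply, Matrix.sub_apply, Matrix.smul_apply, h.moment_eq hT i j,
      intervalIntegral.integral_neg, smul_eq_mul]
    ring
  have hint : ∀ i j, IntervalIntegrable
      (fun s ↦ -(A * moment x P s + moment x P s * Aᵀ) i j) volume 0 T := by
    intro i j
    refine IntervalIntegrable.neg ?_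
    simp only [Matrix.add_apply, Matrix.mul_apply]
    refine IntervalIntegrable.add ?_ ?_
    · have := IntervalIntegrable.sum Finset.univ (f := fun k s ↦ A i k * moment x P s k j)
        (fun k _ ↦ (h.intervalIntegrable_moment hT k j).const_mul (A i k))
      simpa only [Finset.sum_fn] using this
    · have := IntervalIntegrable.sum Finset.univ (f := fun k s ↦ moment x P s i k * Aᵀ k j)
        (fun k _ ↦ (h.intervalIntegrable_moment hT i k).mul_const (Aᵀ k j))
      simpa only [Finset.sum_fn] using this
  have htrace : Matrix.trace ((moment x P 0 - moment x P T + T • V) * X) =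
      ∫ s in (0 : ℝ)..T, ∑ i, ∑ j, -(A * moment x P s + moment x P s * Aᵀ) i j * X j i := by
    simp only [Matrix.trace, Matrix.diag_apply, Matrix.mul_apply (N := X), hdrift]
    rw [intervalIntegral.integral_finsetSum]
    · refine Finset.sum_congr rfl fun i _ ↦ ?_
      rw [intervalIntegral.integral_finsetSum]
      · simp only [intervalIntegral.integral_mul_const]
      · exact fun j _ ↦ (hint i j).mul_const _
    · intro i _
      have := IntervalIntegrable.sum Finset.univ
        (f := fun j s ↦ -(A * moment x P s + moment x P s * Aᵀ) i j * X j i)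
        (fun j _ ↦ (hint i j).mul_const _)
      simpa only [Finset.sum_fn] using this
  rw [htrace]
  refine intervalIntegral.integral_congr fun s hs ↦ ?_
  rw [Set.uIcc_of_le hT] at hs
  have hxs := fun k ↦ memLp_apply (h.memLp_state hs.1) k
  have hI : ∀ k l, Integrable (fun ω ↦ x s ω k * x s ω l) P :=
    fun k l ↦ (hxs k).integrable_mul (hxs l)
  have hquad : ∫ ω, (x s ω).ofLp ⬝ᵥ (Q *ᵥ (x s ω).ofLp) ∂P = Matrix.trace (Q * moment x P s) := by
    simp only [quadratic_eq_sum]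
    have hIQ : ∀ i j, Integrable (fun ω ↦ Q i j * (x s ω i * x s ω j)) P :=
      fun i j ↦ (hI i j).const_mul _
    rw [integral_finsetSum _ fun i _ ↦ integrable_finsetSum _ fun j _ ↦ hIQ i j]
    simp only [Matrix.trace, Matrix.diag_apply, Matrix.mul_apply]
    refine Finset.sum_congr rfl fun i _ ↦ ?_
    rw [integral_finsetSum _ fun j _ ↦ hIQ i j]
    refine Finset.sum_congr rfl fun j _ ↦ ?_
    simp only [integral_const_mul, moment, Matrix.of_apply, mul_comm (x s _ i)]
  have hsum : ∑ i, ∑ j, -(A * moment x P s + moment x P s * Aᵀ) i j * X j i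
      = Matrix.trace (-(A * moment x P s + moment x P s * Aᵀ) * X) := by
    simp only [Matrix.trace, Matrix.diag_apply, Matrix.mul_apply (N := X), Matrix.neg_apply]
  simp only
  rw [hquad, hsum]
  have hQ : Q = -(Aᵀ * X + X * A) := eq_neg_of_add_eq_zero_right hX
  rw [hQ]
  set S := moment x P s
  simp only [neg_mul, Matrix.trace_neg, add_mul, Matrix.trace_add]
  have e1 : Matrix.trace (A * S * X) = Matrix.trace (X * A * S) := by
    rw [Matrix.trace_mul_comm (A * S) X, mul_assoc]
  have e2 : Matrix.trace (S * Aᵀ * X) = Matrix.trace (Aᵀ * X * S) := by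
    rw [mul_assoc, Matrix.trace_mul_comm]
  rw [e1, e2, add_comm]

end RegularSystem

/-! ### Second order properties of Brownian motion -/

namespace IsBrownianMotion

variable {V : Matrix (Fin n) (Fin n) ℝ} {w : ℝ≥0 → Ω → State n} {P : Measure Ω}

lemma hasLaw (hw : IsBrownianMotion V w P) (t : ℝ≥0) :
    HasLaw (w t) (multivariateGaussian 0 ((t : ℝ) • V)) P := by
  have h := hw.law_increment 0 t zero_le
  simp only [NNReal.coe_zero, sub_zero] at h
  refine h.congr ?_
  filter_upwards [hw.zero] with ω hω
  rw [hω, sub_zero]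

lemma memLp (hw : IsBrownianMotion V w P) (t : ℝ≥0) : MemLp (w t) 2 P :=
  (hw.hasLaw t).hasGaussianLaw.memLp_two

lemma integral_apply (hw : IsBrownianMotion V w P) (t : ℝ≥0) (i : Fin n) :
    ∫ ω, w t ω i ∂P = 0 := by
  have h1 := (EuclideanSpace.proj (𝕜 := ℝ) i : State n →L[ℝ] ℝ).integral_comp_comm
    (hw.hasLaw t).hasGaussianLaw.integrable
  have h2 : ∫ ω, w t ω ∂P = 0 := by
    rw [(hw.hasLaw t).integral_eq, integral_id_multivariateGaussian]
  rw [h2, map_zero] at h1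
  exact h1

lemma integral_mul [IsProbabilityMeasure P] (hV : V.PosSemidef) (hw : IsBrownianMotion V w P)
    (t : ℝ≥0) (i j : Fin n) : ∫ ω, w t ω i * w t ω j ∂P = t * V i j := by
  have hcov := (hw.hasLaw t).covariance_fun_comp (f := fun v : State n ↦ v i)
    (g := fun v : State n ↦ v j) (by fun_prop) (by fun_prop)
  rw [covariance_eval_multivariateGaussian (hV.smul t.coe_nonneg),
    covariance_eq_sub (memLp_apply (hw.memLp t) i) (memLp_apply (hw.memLp t) j),
    hw.integral_apply, hw.integral_apply, mul_zero, sub_zero, Matrix.smul_apply] at hcov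
  exact hcov

lemma integral_mul_increment (hw : IsBrownianMotion V w P) {r s t : ℝ≥0} (hrs : r ≤ s)
    (hst : s ≤ t) (i j : Fin n) : ∫ ω, w r ω i * (w t ω j - w s ω j) ∂P = 0 := by
  have hind : IndepFun (fun ω ↦ w r ω i) (fun ω ↦ w t ω j - w s ω j) P := by
    -- Along 0, r, s, t, increments number 0 and 2 are w(r) - w(0) and w(t) - w(s); the first is
    -- w(r) almost surely.
    let τ : ℕ → ℝ≥0
      | 0 => 0
      | 1 => r
      | 2 => s
      | _ => t
    have hτ : Monotone τ := by
      refine monotone_nat_of_le_succ fun k ↦ ?_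
      match k with
      | 0 => exact zero_le
      | 1 => exact hrs
      | 2 => exact hst
      | k + 3 => exact le_rfl
    have h := (hw.indep_increments.nat hτ).indepFun (by decide : (0 : ℕ) ≠ 2)
    have h' := h.comp (φ := fun v : State n ↦ v i) (ψ := fun v : State n ↦ v j)
      (by fun_prop) (by fun_prop)
    refine h'.congr ?_ (Filter.Eventually.of_forall fun ω ↦ rfl)
    filter_upwards [hw.zero] with ω hω
    change (w r ω - w 0 ω) i = w r ω i
    rw [hω, sub_zero]
  have hr := memLp_apply (hw.memLp r) i
  have ht := (memLp_apply (hw.memLp t) j)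
  have hs := (memLp_apply (hw.memLp s) j)
  have hmean : ∫ ω, (w t ω j - w s ω j) ∂P = 0 := by
    have : IsProbabilityMeasure P := (hw.hasLaw t).isProbabilityMeasure
    rw [integral_sub (ht.integrable one_le_two) (hs.integrable one_le_two), hw.integral_apply,
      hw.integral_apply, sub_zero]
  rw [hind.integral_fun_mul_eq_mul_integral hr.1 (ht.sub hs).1, hmean, mul_zero]

lemma integral_mul_of_indepFun (hw : IsBrownianMotion V w P) {x₀ : Ω → State n}
    (hx₀ : AEMeasurable x₀ P) (h : IndepFun x₀ (fun ω t ↦ w t ω) P) (t : ℝ≥0) (i j : Fin n) :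
    ∫ ω, x₀ ω i * w t ω j ∂P = 0 := by
  have hind : IndepFun (fun ω ↦ x₀ ω i) (fun ω ↦ w t ω j) P :=
    h.comp (φ := fun v : State n ↦ v i) (ψ := fun p : ℝ≥0 → State n ↦ p t j)
      (by fun_prop) (by fun_prop)
  have hm : AEStronglyMeasurable (fun ω ↦ x₀ ω i) P :=
    AEMeasurable.aestronglyMeasurable (by fun_prop)
  rw [hind.integral_fun_mul_eq_mul_integral hm (memLp_apply (hw.memLp t) j).1, hw.integral_apply,
    mul_zero]

end IsBrownianMotion

/-! ### Reduction to a regular system -/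

/-- Replacing the noise and the solution by continuous and measurable versions. -/
lemma exists_regularSystem {A V : Matrix (Fin n) (Fin n) ℝ} (hV : V.PosSemidef)
    {w x : ℝ≥0 → Ω → State n} {P : Measure Ω} [IsProbabilityMeasure P]
    (hw : IsBrownianMotion V w P) (hx₀ : HasGaussianLaw (x 0) P)
    (hindep : IndepFun (x 0) (fun ω t ↦ w t ω) P) (hx : IsSolution A w x P) :
    ∃ w' x' : ℝ → Ω → State n, RegularSystem A V w' x' P ∧
      ∀ᵐ ω ∂P, ∀ t : ℝ, x' t ω = x t.toNNReal ω := by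
  obtain ⟨Nw, hNw, hw'⟩ := exists_measurable_continuous_modification
    (fun t ↦ (hw.hasLaw t).aemeasurable) hw.continuous_paths
  obtain ⟨Nx, hNx, hx'⟩ := exists_measurable_continuous_modification
    hx.aemeasurable hx.continuous_paths
  -- One measurable null set covers the exceptional sets of w, of x and of the integral equation. On
  -- it both processes become 0, which still solves the equation.
  let N := toMeasurable P (Nw ∪ Nx ∪ {ω | ¬ ∀ t : ℝ≥0,
    x t ω = x 0 ω + (∫ s in (0 : ℝ)..t, Matrix.toEuclideanLin A (x s.toNNReal ω)) + w t ω})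
  have hsub := subset_toMeasurable P (Nw ∪ Nx ∪ {ω | ¬ ∀ t : ℝ≥0,
    x t ω = x 0 ω + (∫ s in (0 : ℝ)..t, Matrix.toEuclideanLin A (x s.toNNReal ω)) + w t ω})
  have hNm : MeasurableSet N := measurableSet_toMeasurable _ _
  have hN0 : P N = 0 := by
    rw [measure_toMeasurable]
    exact measure_union_null (measure_union_null hNw hNx) (ae_iff.1 hx.integral_eq)
  have hNae : ∀ᵐ ω ∂P, ω ∉ N := measure_eq_zero_iff_ae_notMem.1 hN0
  obtain ⟨hwc, hwm⟩ := hw' N (fun ω hω ↦ hsub (Or.inl (Or.inl hω))) hNm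
  obtain ⟨hxc, hxm⟩ := hx' N (fun ω hω ↦ hsub (Or.inl (Or.inr hω))) hNm
  have hwae : ∀ᵐ ω ∂P, ∀ t : ℝ, Nᶜ.indicator (w t.toNNReal) ω = w t.toNNReal ω := by
    filter_upwards [hNae] with ω hω t using Set.indicator_of_mem hω _
  have hxae : ∀ᵐ ω ∂P, ∀ t : ℝ, Nᶜ.indicator (x t.toNNReal) ω = x t.toNNReal ω := by
    filter_upwards [hNae] with ω hω t using Set.indicator_of_mem hω _
  refine ⟨fun t ↦ Nᶜ.indicator (w t.toNNReal), fun t ↦ Nᶜ.indicator (x t.toNNReal), ?_, hxae⟩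
  exact
    { measurable_noise := fun t ↦ hwm _
      continuous_noise := fun ω ↦ (hwc ω).comp continuous_real_toNNReal
      measurable_state := fun t ↦ hxm _
      continuous_state := fun ω ↦ (hxc ω).comp continuous_real_toNNReal
      integral_eq := by
        intro ω t ht
        by_cases hω : ω ∈ N
        · simp [hω]
        · have hgood : ∀ t : ℝ≥0, x t ω = x 0 ω + (∫ s in (0 : ℝ)..t,
              Matrix.toEuclideanLin A (x s.toNNReal ω)) + w t ω := by
            by_contra hcon
            exact hω (hsub (Or.inr hcon))
          have := hgood t.toNNReal
          rw [Real.coe_toNNReal t ht] at this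
          simpa [hω] using this
      memLp_zero := by
        refine (memLp_congr_ae ?_).2 hx₀.memLp_two
        filter_upwards [hxae] with ω hω
        simpa using hω 0
      memLp_noise := by
        intro t _
        refine (memLp_congr_ae ?_).2 (hw.memLp t.toNNReal)
        filter_upwards [hwae] with ω hω using hω t
      moment_noise := by
        intro t ht i j
        have := hw.integral_mul hV t.toNNReal i j
        rw [Real.coe_toNNReal t ht] at this
        rw [← this]
        refine integral_congr_ae ?_
        filter_upwards [hwae] with ω hω
        simp only [hω]
      orthogonal_zero := by
        intro t _ i j
        refine (integral_congr_ae ?_).trans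
          (hw.integral_mul_of_indepFun hx₀.aemeasurable hindep t.toNNReal i j)
        filter_upwards [hwae, hxae] with ω hω hω'
        have h0 : Nᶜ.indicator (x 0) ω = x 0 ω := by simpa using hω' 0
        simp only [hω, h0, Real.toNNReal_zero]
      orthogonal_increment := by
        intro r s t _ hrs hst i j
        refine (integral_congr_ae ?_).trans (hw.integral_mul_increment
          (Real.toNNReal_le_toNNReal hrs) (Real.toNNReal_le_toNNReal hst) i j)
        filter_upwards [hwae] with ω hω
        simp only [hω] }

end LQG

end

theorem theorem3 {n : ℕ} {Ω : Type*} {mΩ : MeasurableSpace Ω}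
    (P : Measure Ω) [IsProbabilityMeasure P]
    (A V Q : Matrix (Fin n) (Fin n) ℝ)
    (hV : V.PosSemidef) (hQ : Q.IsSymm) (hA : LQG.IsSylvester A)
    (w x : ℝ≥0 → Ω → LQG.State n)
    (hw : LQG.IsBrownianMotion V w P)
    (hx₀ : HasGaussianLaw (x 0) P)
    (hindep : IndepFun (x 0) (fun ω t ↦ w t ω) P)
    (hx : LQG.IsSolution A w x P)
    (α : ℝ) (hα : α = 0) (T : ℝ≥0) :
    (∃! X : Matrix (Fin n) (Fin n) ℝ, LQG.IsDualLyapunovSolution A Q X) ∧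
    (∀ t i j, Integrable (fun ω ↦ x t ω i * x t ω j) P) ∧
    Integrable (LQG.finiteTimeCost α Q x T) P ∧
    ∀ X : Matrix (Fin n) (Fin n) ℝ, LQG.IsDualLyapunovSolution A Q X →
      ∫ ω, LQG.finiteTimeCost α Q x T ω ∂P =
        Matrix.trace ((LQG.secondMoment x P 0 - LQG.secondMoment x P T + (T : ℝ) • V) * X) := by
  obtain ⟨w', x', h, hae⟩ := LQG.exists_regularSystem hV hw hx₀ hindep hx
  have hcost : (fun ω ↦ ∫ t in (0 : ℝ)..T, (x' t ω).ofLp ⬝ᵥ (Q *ᵥ (x' t ω).ofLp))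
      =ᵐ[P] LQG.finiteTimeCost α Q x T := by
    filter_upwards [hae] with ω hω
    simp [LQG.finiteTimeCost, hα, hω]
  have hmom : ∀ t : ℝ≥0, LQG.secondMoment x P t = LQG.RegularSystem.moment x' P t := by
    intro t
    ext i j
    refine integral_congr_ae ?_
    filter_upwards [hae] with ω hω
    simp only [hω, Real.toNNReal_coe]
  refine ⟨LQG.existsUnique_lyapunov hA Q, fun t i j ↦ ?_,
    (h.integrable_cost Q T.coe_nonneg).congr hcost, fun X hX ↦ ?_⟩
  · have hx't := h.memLp_state t.coe_nonneg
    have hint : Integrable (fun ω ↦ x' t ω i * x' t ω j) P :=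
      (LQG.memLp_apply hx't i).integrable_mul (LQG.memLp_apply hx't j)
    refine hint.congr ?_
    filter_upwards [hae] with ω hω
    simp only [hω, Real.toNNReal_coe]
  · rw [← integral_congr_ae hcost, h.integral_cost hX T.coe_nonneg, hmom, hmom, NNReal.coe_zero]
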